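/- Call an infinite sequence $\mathcal{A}$ of positive integers *almost dense* if for every $\eta > 0$ there is a constant $c_{\eta,\mathcal{A}} > 0$ such that $$\#\{X \le n \le 2X : n \in \mathcal{A}\} \ge c_{\eta,\mathcal{A}}\, X^{1-\eta/4}$$ for all sufficiently large real $X$. There are absolute constants $c, C > 0$ such that the following holds. Let $\varepsilon > 0$ and let $\mathcal{A}_1, \mathcal{A}_2$ be almost dense sequences. Then, for all sufficiently large real $x$ (depending on $\varepsilon$, $\mathcal{A}_1$, $\mathcal{A}_2$), the interval $[x, x + x^{5/9+\varepsilon}]$ contains an integer of the form $m a_1 a_2$ with $a_1 \in \mathcal{A}_1$, $a_2 \in \mathcal{A}_2$, $m$ a positive integer, and $$c\,x^{1/3} \le m,\ a_1,\ a_2 \le C\,x^{1/3}.$$ -/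

import Mathlib

/-- An infinite sequence `A` of positive integers, regarded as a set, is almost dense if for every
`ε > 0` there is `c > 0` such that `#{X ≤ n ≤ 2X : n ∈ A} ≥ c X ^ (1 - ε / 4)` for all
sufficiently large real `X`. -/
structure AlmostDense (A : Set ℕ) : Prop where
  pos : ∀ n ∈ A, 0 < n
  infinite : A.Infinite
  dense : ∀ ε : ℝ, 0 < ε → ∃ c : ℝ, 0 < c ∧ ∀ᶠ X : ℝ in Filter.atTop,
    c * X ^ (1 - ε / 4) ≤ ({n : ℕ | n ∈ A ∧ X ≤ (n : ℝ) ∧ (n : ℝ) ≤ 2 * X}.ncard : ℝ)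

open Finset

/-! Put X = x^(1/3) and H ≍ X^(2/3). If no product works, then for each a₁ ∈ A₁ ∩ [X, 2X] an
interval of length about 2H starting at X³/a₁ has no multiple of any a₂ ∈ A₂ ∩ [X, 2X]. So (n, n +
H] has none for every n in a set I of #S₁·H integers of size ≍ X². On I the count of multiples
misses its mean, at least H·#S₂/(2X), entirely.

This contradicts a variance bound. Over a full common period, the Chinese remainder theorem bounds
the mean square deviation by H ∑ gcd(a,b)/(ab) ≪ H log X. The full period is astronomically long,
but a product of two functions of periods a, b ≤ M has period lcm(a,b) ≤ M², so a Fejér weight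
localised at scale M² ≍ X² cannot tell its local average from the global one (`sum_fejerWeight_mul`,
`sum_sq_window_le`). Hence #S₁ #S₂² H² ≪ X⁴ log X, which fails for almost dense sequences. -/

/-! ### Periodic sums and additive characters -/

/-- The sum of a periodic function over a full period is invariant under translation. -/
theorem sum_Ico_period_shift {R : Type*} [AddCommGroup R] (f : ℤ → R) (Q c : ℤ) (hQ : 0 ≤ Q)
    (hf : ∀ n, f (n + Q) = f n) (l : ℤ) :
    ∑ n ∈ Ico c (c + Q), f (n + l) = ∑ n ∈ Ico c (c + Q), f n := by
  have step : ∀ j : ℤ, ∑ n ∈ Ico c (c + Q), f (n + (j + 1)) = ∑ n ∈ Ico c (c + Q), f (n + j) := by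
    intro j
    rcases hQ.eq_or_lt with rfl | hQ
    · simp
    have h1 : ∑ n ∈ Ico c (c + Q), f (n + (j + 1)) = ∑ n ∈ Ico (c + 1) (c + Q + 1), f (n + j) := by
      refine Finset.sum_bij' (fun n _ => n + 1) (fun n _ => n - 1) ?_ ?_ ?_ ?_ ?_
      · intro n hn; simp only [mem_Ico] at hn ⊢; omega
      · intro n hn; simp only [mem_Ico] at hn ⊢; omega
      · intro n _; ring
      · intro n _; ring
      · intro n _; congr 1; ring
    have h2 : Ico c (c + Q) = insert c (Ico (c + 1) (c + Q)) := by
      ext n; simp only [mem_Ico, mem_insert]; omega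
    have h3 : Ico (c + 1) (c + Q + 1) = insert (c + Q) (Ico (c + 1) (c + Q)) := by
      ext n; simp only [mem_Ico, mem_insert]; omega
    rw [h1, h2, h3, sum_insert (by simp), sum_insert (by simp)]
    congr 1
    rw [← hf (c + j)]; congr 1; ring
  induction l using Int.induction_on with
  | zero => simp
  | succ i ih => rw [step, ih]
  | pred i ih =>
    rw [← ih, ← step]
    exact sum_congr rfl fun n _ => by congr 1; ring

/-- The additive character `n ↦ exp (2 π i n / Q)`. -/
noncomputable def unitExp (Q : ℤ) (n : ℤ) : ℂ := Complex.exp (2 * Real.pi * Complex.I * (n / Q))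

theorem unitExp_add (Q m n : ℤ) : unitExp Q (m + n) = unitExp Q m * unitExp Q n := by
  rw [unitExp, unitExp, unitExp, ← Complex.exp_add]; congr 1; push_cast; ring

theorem unitExp_zero (Q : ℤ) : unitExp Q 0 = 1 := by simp [unitExp]

theorem unitExp_eq_one_iff {Q : ℤ} (hQ : Q ≠ 0) (n : ℤ) : unitExp Q n = 1 ↔ Q ∣ n := by
  have hQ' : (Q : ℂ) ≠ 0 := by exact_mod_cast hQ
  have hpi : (2 * Real.pi * Complex.I : ℂ) ≠ 0 := Complex.two_pi_I_ne_zero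
  rw [unitExp, Complex.exp_eq_one_iff]
  constructor
  · rintro ⟨k, hk⟩
    refine ⟨k, ?_⟩
    rw [mul_comm (k : ℂ)] at hk
    have := mul_left_cancel₀ hpi hk
    rw [div_eq_iff hQ'] at this
    rw [mul_comm]; exact_mod_cast this
  · rintro ⟨k, rfl⟩
    refine ⟨k, ?_⟩
    push_cast
    field_simp

theorem conj_unitExp (Q n : ℤ) : (starRingEnd ℂ) (unitExp Q n) = unitExp Q (-n) := by
  rw [unitExp, unitExp, ← Complex.exp_conj]
  congr 1
  simp [Complex.conj_ofReal, Complex.conj_ofNat]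
  ring

theorem unitExp_re (Q n : ℤ) : (unitExp Q n).re = Real.cos (2 * Real.pi * (n / Q)) := by
  have : (2 * Real.pi * Complex.I * (n / Q) : ℂ) = ((2 * Real.pi * (n / Q) : ℝ) : ℂ) * Complex.I := by
    push_cast; ring
  rw [unitExp, this, Complex.exp_ofReal_mul_I_re]

/-- A function of period `l ∣ Q` is orthogonal to each character modulo `Q` that is not of
period `l`. -/
theorem sum_unitExp_mul_eq_zero (P : ℤ → ℂ) (Q l c k : ℤ) (hQ : 0 < Q) (hlQ : l ∣ Q)
    (hP : ∀ n, P (n + l) = P n) (hk : ¬ Q ∣ k * l) :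
    ∑ n ∈ Ico c (c + Q), unitExp Q (k * n) * P n = 0 := by
  have hPQ : ∀ n, P (n + Q) = P n := by
    obtain ⟨t, rfl⟩ := hlQ
    intro n
    have : Function.Periodic P l := hP
    simpa [mul_comm] using this.int_mul t n
  have hper : ∀ n, unitExp Q (k * (n + Q)) * P (n + Q) = unitExp Q (k * n) * P n := by
    intro n
    rw [hPQ, mul_add, unitExp_add, (unitExp_eq_one_iff hQ.ne' _).2 (Dvd.intro_left k rfl), mul_one]
  have hs := sum_Ico_period_shift (fun n => unitExp Q (k * n) * P n) Q c hQ.le hper l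
  simp only [hP, mul_add, unitExp_add] at hs
  have hs' : unitExp Q (k * l) * ∑ n ∈ Ico c (c + Q), unitExp Q (k * n) * P n =
      ∑ n ∈ Ico c (c + Q), unitExp Q (k * n) * P n := by
    conv_rhs => rw [← hs]
    rw [mul_sum]
    exact sum_congr rfl fun n _ => by ring
  have hne : unitExp Q (k * l) - 1 ≠ 0 := sub_ne_zero.2 fun h => hk ((unitExp_eq_one_iff hQ.ne' _).1 h)
  have : (unitExp Q (k * l) - 1) * ∑ n ∈ Ico c (c + Q), unitExp Q (k * n) * P n = 0 := by
    rw [sub_mul, hs', one_mul, sub_self]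
  exact (mul_eq_zero.1 this).resolve_left hne

/-! ### Fejér weights and the large sieve inequality -/

/-- The (unnormalised) Fejér weight of order `K` modulo `Q`. -/
noncomputable def fejerWeight (Q : ℤ) (K : ℕ) (n : ℤ) : ℝ :=
  Complex.normSq (∑ k ∈ range K, unitExp Q (k * n))

theorem fejerWeight_nonneg (Q : ℤ) (K : ℕ) (n : ℤ) : 0 ≤ fejerWeight Q K n := Complex.normSq_nonneg _

theorem fejerWeight_eq_sum (Q : ℤ) (K : ℕ) (n : ℤ) :
    (fejerWeight Q K n : ℂ) = ∑ k ∈ range K, ∑ j ∈ range K, unitExp Q (((k : ℤ) - j) * n) := by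
  rw [fejerWeight, ← Complex.mul_conj, map_sum, sum_mul_sum]
  refine sum_congr rfl fun k _ => sum_congr rfl fun j _ => ?_
  rw [conj_unitExp, ← unitExp_add]
  congr 1; ring

/-- The weight has frequencies k - j with |k - j| < K ≤ Q / l. Those off the diagonal are too small
for Q to divide (k - j) * l, so they are orthogonal to `P`; the K diagonal terms remain. -/
theorem sum_fejerWeight_mul_complex (P : ℤ → ℂ) (Q l c : ℤ) (K : ℕ) (hQ : 0 < Q) (hl : 0 < l)
    (hlQ : l ∣ Q) (hlK : l * K ≤ Q) (hP : ∀ n, P (n + l) = P n) :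
    ∑ n ∈ Ico c (c + Q), (fejerWeight Q K n : ℂ) * P n = K * ∑ n ∈ Ico c (c + Q), P n := by
  simp only [fejerWeight_eq_sum, sum_mul]
  rw [sum_comm]
  have : ∀ k ∈ range K, ∑ n ∈ Ico c (c + Q), ∑ j ∈ range K, unitExp Q (((k : ℤ) - j) * n) * P n =
      ∑ n ∈ Ico c (c + Q), P n := by
    intro k hk
    rw [sum_comm, sum_eq_single k]
    · simp [unitExp_zero]
    · intro j hj hjk
      refine sum_unitExp_mul_eq_zero P Q l c _ hQ hlQ hP fun hdvd => ?_
      rw [mem_range] at hk hj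
      have hne : ((k : ℤ) - j) * l ≠ 0 := mul_ne_zero (by omega) hl.ne'
      have h1 := Int.le_of_dvd (abs_pos.2 hne) ((dvd_abs _ _).2 hdvd)
      rw [abs_mul, abs_of_pos hl] at h1
      have h2 : |(k : ℤ) - j| < K := by rw [abs_lt]; omega
      nlinarith
    · exact fun h => absurd hk h
  rw [sum_congr rfl this, sum_const, card_range, nsmul_eq_mul]

/-- Against functions of a short period, the Fejér weight of order `K` has average `K`. -/
theorem sum_fejerWeight_mul (P : ℤ → ℝ) (Q l c y : ℤ) (K : ℕ) (hQ : 0 < Q) (hl : 0 < l)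
    (hlQ : l ∣ Q) (hlK : l * K ≤ Q) (hP : ∀ n, P (n + l) = P n) :
    ∑ n ∈ Ico c (c + Q), fejerWeight Q K (n - y) * P n = K * ∑ n ∈ Ico c (c + Q), P n := by
  have hPQ : ∀ n, P (n + Q) = P n := by
    obtain ⟨t, rfl⟩ := hlQ
    intro n
    have : Function.Periodic P l := hP
    simpa [mul_comm] using this.int_mul t n
  have hwQ : ∀ n, fejerWeight Q K (n + Q) = fejerWeight Q K n := by
    intro n
    unfold fejerWeight
    congr 1
    refine sum_congr rfl fun k _ => ?_
    rw [mul_add, unitExp_add, (unitExp_eq_one_iff hQ.ne' _).2 (Dvd.intro_left _ rfl), mul_one]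
  have h := sum_fejerWeight_mul_complex (fun n => (P (n + y) : ℂ)) Q l c K hQ hl hlQ hlK
    (fun n => by rw [add_right_comm, hP])
  have h' : ∑ n ∈ Ico c (c + Q), fejerWeight Q K n * P (n + y) =
      K * ∑ n ∈ Ico c (c + Q), P (n + y) := by exact_mod_cast h
  rw [← sum_Ico_period_shift P Q c hQ.le hPQ y, ← h', ← sum_Ico_period_shift
    (fun n => fejerWeight Q K (n - y) * P n) Q c hQ.le (fun n => ?_) y]
  · simp
  · rw [hPQ, add_sub_right_comm, hwQ]

/-- All phases are at most π/3 in absolute value, so each term has real part at least 1/2. -/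
theorem le_fejerWeight (Q : ℤ) (K : ℕ) (n : ℤ) (hQ : 0 < Q) (hn : 6 * |n| * K ≤ Q) :
    (K : ℝ) ^ 2 / 4 ≤ fejerWeight Q K n := by
  have hQ' : (0 : ℝ) < Q := by exact_mod_cast hQ
  have hn' : 6 * |(n : ℝ)| * K ≤ Q := by exact_mod_cast hn
  have hre : (K : ℝ) / 2 ≤ (∑ k ∈ range K, unitExp Q (k * n)).re := by
    rw [Complex.re_sum]
    have : ∀ k ∈ range K, (1 / 2 : ℝ) ≤ (unitExp Q (k * n)).re := by
      intro k hk
      rw [unitExp_re, ← Real.cos_abs, ← Real.cos_pi_div_three]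
      have hkK : (k : ℝ) ≤ K := by exact_mod_cast (mem_range.1 hk).le
      have hb : |2 * Real.pi * (((k * n : ℤ) : ℝ) / Q)| ≤ Real.pi / 3 := by
        push_cast
        rw [abs_mul, abs_of_pos Real.two_pi_pos, abs_div, abs_mul, abs_of_pos hQ', Nat.abs_cast]
        have : (k : ℝ) * |(n : ℝ)| / Q ≤ 1 / 6 := by
          rw [div_le_iff₀ hQ']
          nlinarith [mul_le_mul_of_nonneg_right hkK (abs_nonneg (n : ℝ))]
        nlinarith [Real.pi_pos]
      exact Real.cos_le_cos_of_nonneg_of_le_pi (abs_nonneg _) (by linarith [Real.pi_pos]) hb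
    have := card_nsmul_le_sum _ _ _ this
    rw [card_range, nsmul_eq_mul] at this
    linarith
  have hK : (0 : ℝ) ≤ K := by positivity
  rw [fejerWeight, Complex.normSq_apply]
  nlinarith [mul_self_nonneg (∑ k ∈ range K, unitExp Q (k * n)).im]

/-- A large sieve inequality in physical space: the mean square over a window of a sum of functions
with periods at most `M` is controlled by the mean square over a full period. -/
theorem sum_sq_window_le (S : Finset ℕ) (M : ℕ) (hS : ∀ a ∈ S, 0 < a ∧ a ≤ M) (f : ℕ → ℤ → ℝ)
    (hf : ∀ a ∈ S, ∀ n, f a (n + a) = f a n) (K : ℕ) (hK : 0 < K) (hM : 0 < M)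
    (hSK : ∀ a ∈ S, a ∣ K) (c y : ℤ) (I : Finset ℤ) (hI : I ⊆ Ico c (c + M ^ 2 * K))
    (hIy : ∀ n ∈ I, 6 * |n - y| ≤ M ^ 2) :
    K * ∑ n ∈ I, (∑ a ∈ S, f a n) ^ 2 ≤
      4 * ∑ n ∈ Ico c (c + M ^ 2 * K), (∑ a ∈ S, f a n) ^ 2 := by
  set Q : ℤ := M ^ 2 * K with hQdef
  have hQ : 0 < Q := by positivity
  -- Expanding the square, each product f a * f b has period lcm(a, b) ≤ M² = Q / K, short enough
  -- for the Fejér identity.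
  have key : ∑ n ∈ Ico c (c + Q), fejerWeight Q K (n - y) * (∑ a ∈ S, f a n) ^ 2 =
      K * ∑ n ∈ Ico c (c + Q), (∑ a ∈ S, f a n) ^ 2 := by
    simp only [pow_two (∑ a ∈ S, _), sum_mul_sum]
    simp only [mul_sum]
    rw [sum_comm, sum_comm (s := Ico c (c + Q))]
    refine sum_congr rfl fun a ha => ?_
    rw [sum_comm, sum_comm (s := Ico c (c + Q))]
    refine sum_congr rfl fun b hb => ?_
    rw [← mul_sum]
    have hper : ∀ d ∈ S, d ∣ a.lcm b → ∀ n, f d (n + (a.lcm b : ℕ)) = f d n := by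
      rintro d hd ⟨t, ht⟩ n
      have : Function.Periodic (f d) (d : ℤ) := hf d hd
      rw [ht]
      simpa [mul_comm] using this.int_mul t n
    refine sum_fejerWeight_mul (fun n => f a n * f b n) Q (a.lcm b : ℕ) c y K hQ ?_ ?_ ?_ fun n => ?_
    · exact_mod_cast Nat.lcm_pos (hS a ha).1 (hS b hb).1
    · have : a.lcm b ∣ M ^ 2 * K := Dvd.dvd.mul_left (Nat.lcm_dvd (hSK a ha) (hSK b hb)) _
      rw [hQdef]; exact_mod_cast this
    · have : a.lcm b ≤ M ^ 2 := by
        refine (Nat.le_of_dvd (Nat.mul_pos (hS a ha).1 (hS b hb).1) (Nat.lcm_dvd_mul a b)).trans ?_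
        rw [pow_two]; exact Nat.mul_le_mul (hS a ha).2 (hS b hb).2
      rw [hQdef]; exact_mod_cast Nat.mul_le_mul_right K this
    · rw [hper a ha (Nat.dvd_lcm_left a b), hper b hb (Nat.dvd_lcm_right a b)]
  have hK' : (0 : ℝ) < K := by exact_mod_cast hK
  have h1 : ∑ n ∈ I, (K : ℝ) ^ 2 / 4 * (∑ a ∈ S, f a n) ^ 2 ≤
      K * ∑ n ∈ Ico c (c + Q), (∑ a ∈ S, f a n) ^ 2 := by
    rw [← key]
    refine (sum_le_sum fun n hn => ?_).trans (sum_le_sum_of_subset_of_nonneg hI fun n _ _ => ?_)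
    · refine mul_le_mul_of_nonneg_right (le_fejerWeight Q K (n - y) hQ ?_) (sq_nonneg _)
      exact mul_le_mul_of_nonneg_right (hIy n hn) (by positivity)
    · exact mul_nonneg (fejerWeight_nonneg _ _ _) (sq_nonneg _)
  rw [← mul_sum] at h1
  have h2 : (K : ℝ) * (K * ∑ n ∈ I, (∑ a ∈ S, f a n) ^ 2) ≤
      K * (4 * ∑ n ∈ Ico c (c + Q), (∑ a ∈ S, f a n) ^ 2) := by nlinarith
  exact le_of_mul_le_mul_left h2 hK'

/-! ### Multiples in short intervals: variance over a full period -/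

theorem card_dvd_add_full_period (Q r c u : ℤ) (hQ : 0 ≤ Q) (hr : 0 < r) (hrQ : r ∣ Q) :
    (#{n ∈ Ico c (c + Q) | r ∣ n + u} : ℝ) = Q / r := by
  have h := Int.Ico_filter_modEq_card c (c + Q) hr (-u)
  have h0 : ({n ∈ Ico c (c + Q) | r ∣ n + u}) = {n ∈ Ico c (c + Q) | n ≡ -u [ZMOD r]} := by
    refine filter_congr fun n _ => ?_
    rw [Int.modEq_comm, Int.modEq_iff_dvd, sub_neg_eq_add]
  obtain ⟨t, rfl⟩ := hrQ
  have hr' : (r : ℚ) ≠ 0 := by exact_mod_cast hr.ne'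
  have hr'' : (r : ℝ) ≠ 0 := by exact_mod_cast hr.ne'
  have ht : 0 ≤ t := nonneg_of_mul_nonneg_right hQ hr
  have e : (((c + r * t : ℤ) : ℚ) - ((-u : ℤ) : ℚ)) / r = ((c : ℚ) - ((-u : ℤ) : ℚ)) / r + (t : ℤ) := by
    push_cast; field_simp; ring
  rw [e, Int.ceil_add_intCast, add_sub_cancel_left, max_eq_left ht] at h
  rw [h0]
  have h' : (#{n ∈ Ico c (c + r * t) | n ≡ -u [ZMOD r]} : ℝ) = t := by exact_mod_cast h
  rw [h']
  push_cast
  field_simp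

/-- Chinese remainder theorem: the two conditions are either incompatible or define one class modulo
lcm(a, b). -/
theorem card_dvd_add_and_dvd_add_le (Q c u v : ℤ) (a b : ℕ) (hQ : 0 ≤ Q) (ha : 0 < a) (hb : 0 < b)
    (haQ : (a : ℤ) ∣ Q) (hbQ : (b : ℤ) ∣ Q) :
    (#{n ∈ Ico c (c + Q) | (a : ℤ) ∣ n + u ∧ (b : ℤ) ∣ n + v} : ℝ) ≤
      if ((a.gcd b : ℕ) : ℤ) ∣ u - v then Q * (a.gcd b : ℝ) / (a * b) else 0 := by
  have ha' : (a : ℝ) ≠ 0 := by positivity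
  have hb' : (b : ℝ) ≠ 0 := by positivity
  have hQ' : (0 : ℝ) ≤ Q := by exact_mod_cast hQ
  rcases ({n ∈ Ico c (c + Q) | (a : ℤ) ∣ n + u ∧ (b : ℤ) ∣ n + v}).eq_empty_or_nonempty with h | h
  · rw [h, card_empty, Nat.cast_zero]
    split_ifs <;> positivity
  obtain ⟨n₀, hn₀⟩ := h
  obtain ⟨-, h1, h2⟩ := mem_filter.1 hn₀
  have hg : ((a.gcd b : ℕ) : ℤ) ∣ u - v := by
    have e : u - v = (n₀ + u) - (n₀ + v) := by ring
    rw [e]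
    exact dvd_sub ((Int.natCast_dvd_natCast.2 (Nat.gcd_dvd_left a b)).trans h1)
      ((Int.natCast_dvd_natCast.2 (Nat.gcd_dvd_right a b)).trans h2)
  rw [if_pos hg]
  have hl : 0 < a.lcm b := Nat.lcm_pos ha hb
  have hlQ : ((a.lcm b : ℕ) : ℤ) ∣ Q := by
    exact Int.natCast_dvd.2 (Nat.lcm_dvd (Int.natCast_dvd.1 haQ) (Int.natCast_dvd.1 hbQ))
  have hsub : ({n ∈ Ico c (c + Q) | (a : ℤ) ∣ n + u ∧ (b : ℤ) ∣ n + v}) ⊆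
      {n ∈ Ico c (c + Q) | ((a.lcm b : ℕ) : ℤ) ∣ n + -n₀} := by
    intro n hn
    obtain ⟨hn, h3, h4⟩ := mem_filter.1 hn
    refine mem_filter.2 ⟨hn, ?_⟩
    refine Int.natCast_dvd.2 (Nat.lcm_dvd (Int.natCast_dvd.1 ?_) (Int.natCast_dvd.1 ?_))
    · simpa [add_sub_add_right_eq_sub, sub_eq_add_neg] using dvd_sub h3 h1
    · simpa [add_sub_add_right_eq_sub, sub_eq_add_neg] using dvd_sub h4 h2
  have hcard : (#{n ∈ Ico c (c + Q) | (a : ℤ) ∣ n + u ∧ (b : ℤ) ∣ n + v} : ℝ) ≤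
      #{n ∈ Ico c (c + Q) | ((a.lcm b : ℕ) : ℤ) ∣ n + -n₀} := by exact_mod_cast card_le_card hsub
  rw [card_dvd_add_full_period Q _ c _ hQ (by exact_mod_cast hl) hlQ] at hcard
  refine hcard.trans (le_of_eq ?_)
  have hgl : (a.gcd b : ℝ) * (a.lcm b : ℝ) = a * b := by exact_mod_cast Nat.gcd_mul_lcm a b
  have hl' : (a.lcm b : ℝ) ≠ 0 := by positivity
  rw [Int.cast_natCast, ← hgl]
  have hg' : (a.gcd b : ℝ) ≠ 0 := by
    have := Nat.gcd_pos_of_pos_left b ha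
    positivity
  field_simp

/-- The number of multiples of `a` in `(n, n + H]`. -/
noncomputable def multCount (H : ℕ) (a : ℕ) (n : ℤ) : ℝ :=
  ∑ u ∈ Ioc (0 : ℤ) H, if (a : ℤ) ∣ n + u then 1 else 0

theorem multCount_add_self (H a : ℕ) (n : ℤ) : multCount H a (n + a) = multCount H a n := by
  unfold multCount
  refine sum_congr rfl fun u _ => ?_
  have : (a : ℤ) ∣ n + a + u ↔ (a : ℤ) ∣ n + u := by
    rw [add_right_comm, dvd_add_self_right]
  simp only [this]

theorem sum_multCount (H a : ℕ) (Q c : ℤ) (hQ : 0 ≤ Q) (ha : 0 < a) (haQ : (a : ℤ) ∣ Q) :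
    ∑ n ∈ Ico c (c + Q), multCount H a n = Q * (H / a) := by
  unfold multCount
  rw [sum_comm]
  have : ∀ u ∈ Ioc (0 : ℤ) H, ∑ n ∈ Ico c (c + Q), (if (a : ℤ) ∣ n + u then (1 : ℝ) else 0) =
      Q / a := by
    intro u _
    rw [sum_boole, card_dvd_add_full_period Q a c u hQ (by exact_mod_cast ha) haQ, Int.cast_natCast]
  rw [sum_congr rfl this, sum_const, nsmul_eq_mul]
  simp
  ring

theorem card_Ioc_filter_dvd_sub_le (H g : ℕ) (hg : 0 < g) (u : ℤ) :
    (#{v ∈ Ioc (0 : ℤ) H | (g : ℤ) ∣ u - v} : ℝ) ≤ H / g + 1 := by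
  have h := Int.Ioc_filter_modEq_card 0 H (r := g) (by exact_mod_cast hg) u
  have h0 : ({v ∈ Ioc (0 : ℤ) H | (g : ℤ) ∣ u - v}) = {v ∈ Ioc (0 : ℤ) H | v ≡ u [ZMOD g]} := by
    refine filter_congr fun v _ => ?_
    rw [Int.modEq_iff_dvd]
  rw [h0]
  have hq : ((#{v ∈ Ioc (0 : ℤ) H | v ≡ u [ZMOD g]} : ℤ) : ℚ) ≤ H / g + 1 := by
    rw [h]
    push_cast
    refine max_le ?_ (by positivity)
    have h1 := Int.floor_le (((H : ℚ) - u) / g)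
    have h2 := Int.lt_floor_add_one ((0 - (u : ℚ)) / g)
    have h3 : ((H : ℚ) - u) / g = H / g + (0 - (u : ℚ)) / g := by ring
    linarith
  have := (Rat.cast_le (K := ℝ)).2 hq
  push_cast at this
  exact this

/-- The first term is the product of the means, which cancels in the variance; the second comes from
the `+ 1` in counting v ≡ u modulo the gcd. -/
theorem sum_multCount_mul_le (H a b : ℕ) (Q c : ℤ) (hQ : 0 ≤ Q) (ha : 0 < a) (hb : 0 < b)
    (haQ : (a : ℤ) ∣ Q) (hbQ : (b : ℤ) ∣ Q) :
    ∑ n ∈ Ico c (c + Q), multCount H a n * multCount H b n ≤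
      Q * (H / a) * (H / b) + Q * H * (a.gcd b / (a * b)) := by
  have hQ' : (0 : ℝ) ≤ Q := by exact_mod_cast hQ
  have hg : 0 < a.gcd b := Nat.gcd_pos_of_pos_left b ha
  have hpair : ∀ u v : ℤ, ∑ n ∈ Ico c (c + Q), (if (a : ℤ) ∣ n + u then (1 : ℝ) else 0) *
      (if (b : ℤ) ∣ n + v then (1 : ℝ) else 0) ≤
      if ((a.gcd b : ℕ) : ℤ) ∣ u - v then Q * (a.gcd b : ℝ) / (a * b) else 0 := by
    intro u v
    refine le_trans (le_of_eq ?_) (card_dvd_add_and_dvd_add_le Q c u v a b hQ ha hb haQ hbQ)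
    rw [← sum_boole]
    refine sum_congr rfl fun n _ => ?_
    by_cases h1 : (a : ℤ) ∣ n + u <;> by_cases h2 : (b : ℤ) ∣ n + v <;> simp [h1, h2]
  calc ∑ n ∈ Ico c (c + Q), multCount H a n * multCount H b n
      = ∑ u ∈ Ioc (0 : ℤ) H, ∑ v ∈ Ioc (0 : ℤ) H, ∑ n ∈ Ico c (c + Q),
          (if (a : ℤ) ∣ n + u then (1 : ℝ) else 0) * (if (b : ℤ) ∣ n + v then (1 : ℝ) else 0) := by
        simp only [multCount, sum_mul_sum]
        rw [sum_comm]
        exact sum_congr rfl fun u _ => sum_comm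
    _ ≤ ∑ u ∈ Ioc (0 : ℤ) H, ∑ v ∈ Ioc (0 : ℤ) H,
          if ((a.gcd b : ℕ) : ℤ) ∣ u - v then Q * (a.gcd b : ℝ) / (a * b) else 0 :=
        sum_le_sum fun u _ => sum_le_sum fun v _ => hpair u v
    _ ≤ ∑ u ∈ Ioc (0 : ℤ) H, (H / a.gcd b + 1) * (Q * (a.gcd b : ℝ) / (a * b)) := by
        refine sum_le_sum fun u _ => ?_
        rw [← sum_filter, sum_const, nsmul_eq_mul]
        exact mul_le_mul_of_nonneg_right (card_Ioc_filter_dvd_sub_le H _ hg u) (by positivity)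
    _ = _ := by
        rw [sum_const, nsmul_eq_mul]
        have hg' : (a.gcd b : ℝ) ≠ 0 := by positivity
        simp
        field_simp

/-- The variance over a full period of the number of multiples of elements of `S` in an interval
of length `H`. -/
theorem sum_multCount_sub_sq_le (S : Finset ℕ) (H : ℕ) (Q c : ℤ) (hQ : 0 ≤ Q)
    (hS : ∀ a ∈ S, 0 < a ∧ (a : ℤ) ∣ Q) :
    ∑ n ∈ Ico c (c + Q), (∑ a ∈ S, (multCount H a n - H / a)) ^ 2 ≤
      Q * H * ∑ a ∈ S, ∑ b ∈ S, (a.gcd b : ℝ) / (a * b) := by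
  set E : ℝ := ∑ a ∈ S, (H : ℝ) / a with hE
  have h1 : ∑ n ∈ Ico c (c + Q), ∑ a ∈ S, multCount H a n = Q * E := by
    rw [sum_comm, hE, mul_sum]
    exact sum_congr rfl fun a ha => sum_multCount H a Q c hQ (hS a ha).1 (hS a ha).2
  have h2 : ∑ n ∈ Ico c (c + Q), (∑ a ∈ S, multCount H a n) ^ 2 ≤
      Q * E ^ 2 + Q * H * ∑ a ∈ S, ∑ b ∈ S, (a.gcd b : ℝ) / (a * b) := by
    simp only [pow_two, sum_mul_sum, hE]
    rw [sum_comm]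
    simp only [mul_sum]
    rw [← sum_add_distrib]
    refine sum_le_sum fun a ha => ?_
    rw [sum_comm, ← sum_add_distrib]
    refine sum_le_sum fun b hb => ?_
    have := sum_multCount_mul_le H a b Q c hQ (hS a ha).1 (hS b hb).1 (hS a ha).2 (hS b hb).2
    rwa [mul_assoc (Q : ℝ)] at this
  have h3 : ∑ n ∈ Ico c (c + Q), (∑ a ∈ S, (multCount H a n - H / a)) ^ 2 =
      ∑ n ∈ Ico c (c + Q), (∑ a ∈ S, multCount H a n) ^ 2 - Q * E ^ 2 := by
    have : ∀ n ∈ Ico c (c + Q), (∑ a ∈ S, (multCount H a n - H / a)) ^ 2 =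
        (∑ a ∈ S, multCount H a n) ^ 2 - 2 * E * (∑ a ∈ S, multCount H a n) + E ^ 2 := by
      intro n _
      rw [sum_sub_distrib, ← hE]
      ring
    rw [sum_congr rfl this, sum_add_distrib, sum_sub_distrib, ← mul_sum, h1, sum_const, nsmul_eq_mul]
    have hc : ((#(Ico c (c + Q)) : ℕ) : ℝ) = Q := by
      rw [Int.card_Ico, add_sub_cancel_left]
      exact_mod_cast Int.toNat_of_nonneg hQ
    rw [hc]
    ring
  linarith

/-! ### Average size of the gcd -/

/-- Replace gcd(a, b) by the sum of all common divisors g; at most M / g elements are multiples of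
g, leaving a harmonic sum. -/
theorem sum_gcd_le (S : Finset ℕ) (M : ℕ) (hS : ∀ a ∈ S, 0 < a ∧ a ≤ M) :
    ∑ a ∈ S, ∑ b ∈ S, (a.gcd b : ℝ) ≤ M ^ 2 * (1 + Real.log M) := by
  have hcard : ∀ g ∈ Icc 1 M, (#{a ∈ S | g ∣ a} : ℝ) ≤ M / g := by
    intro g _
    have h : #{a ∈ S | g ∣ a} ≤ M / g := by
      rw [← Nat.Ioc_filter_dvd_card_eq_div]
      refine card_le_card fun a ha => ?_
      obtain ⟨ha, hga⟩ := mem_filter.1 ha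
      exact mem_filter.2 ⟨mem_Ioc.2 (hS a ha), hga⟩
    exact (Nat.cast_le.2 h).trans Nat.cast_div_le
  calc ∑ a ∈ S, ∑ b ∈ S, (a.gcd b : ℝ)
      ≤ ∑ a ∈ S, ∑ b ∈ S, ∑ g ∈ Icc 1 M,
          (g : ℝ) * ((if g ∣ a then 1 else 0) * (if g ∣ b then 1 else 0)) := by
        refine sum_le_sum fun a ha => sum_le_sum fun b hb => ?_
        have hmem : a.gcd b ∈ Icc 1 M := mem_Icc.2 ⟨Nat.gcd_pos_of_pos_left b (hS a ha).1,
          (Nat.gcd_le_left b (hS a ha).1).trans (hS a ha).2⟩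
        refine le_trans (le_of_eq ?_) (single_le_sum (f := fun g : ℕ =>
          (g : ℝ) * ((if g ∣ a then 1 else 0) * (if g ∣ b then 1 else 0))) (fun g _ => ?_) hmem)
        · simp [Nat.gcd_dvd_left, Nat.gcd_dvd_right]
        · positivity
    _ = ∑ g ∈ Icc 1 M, (g : ℝ) * ((#{a ∈ S | g ∣ a} : ℝ) * #{a ∈ S | g ∣ a}) := by
        rw [sum_congr rfl fun a _ => sum_comm, sum_comm]
        refine sum_congr rfl fun g _ => ?_
        simp only [← mul_sum, ← sum_mul, sum_boole]
    _ ≤ ∑ g ∈ Icc 1 M, (M : ℝ) ^ 2 * (g : ℝ)⁻¹ := by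
        refine sum_le_sum fun g hg => ?_
        have hg0 : (0 : ℝ) < g := by exact_mod_cast (mem_Icc.1 hg).1
        have h := hcard g hg
        calc (g : ℝ) * ((#{a ∈ S | g ∣ a} : ℝ) * #{a ∈ S | g ∣ a})
            ≤ g * ((M / g) * (M / g)) := by gcongr
          _ = _ := by field_simp
    _ ≤ _ := by
        rw [← mul_sum]
        refine mul_le_mul_of_nonneg_left ?_ (by positivity)
        have := harmonic_le_one_add_log M
        rw [harmonic_eq_sum_Icc] at this
        push_cast at this
        exact this

theorem sum_gcd_div_mul_le (X : ℝ) (hX : 1 ≤ X) (S : Finset ℕ)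
    (hS : ∀ a ∈ S, X ≤ (a : ℝ) ∧ (a : ℝ) ≤ 2 * X) :
    ∑ a ∈ S, ∑ b ∈ S, (a.gcd b : ℝ) / (a * b) ≤ 4 * (1 + Real.log (2 * X)) := by
  have hX0 : 0 < X := by linarith
  have hM1 : (⌊2 * X⌋₊ : ℝ) ≤ 2 * X := Nat.floor_le (by linarith)
  have hM0 : (0 : ℝ) < ⌊2 * X⌋₊ := by linarith [Nat.sub_one_lt_floor (2 * X)]
  have hlog : Real.log ⌊2 * X⌋₊ ≤ Real.log (2 * X) := Real.log_le_log hM0 hM1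
  have hlog0 : 0 ≤ Real.log ⌊2 * X⌋₊ := Real.log_natCast_nonneg _
  calc ∑ a ∈ S, ∑ b ∈ S, (a.gcd b : ℝ) / (a * b)
      ≤ ∑ a ∈ S, ∑ b ∈ S, (a.gcd b : ℝ) / X ^ 2 := by
        refine sum_le_sum fun a ha => sum_le_sum fun b hb => ?_
        have h1 := (hS a ha).1
        have h2 := (hS b hb).1
        refine div_le_div_of_nonneg_left (by positivity) (by positivity) ?_
        rw [pow_two]
        exact mul_le_mul h1 h2 hX0.le (by linarith)
    _ = (∑ a ∈ S, ∑ b ∈ S, (a.gcd b : ℝ)) / X ^ 2 := by simp only [sum_div]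
    _ ≤ (⌊2 * X⌋₊ : ℝ) ^ 2 * (1 + Real.log ⌊2 * X⌋₊) / X ^ 2 := by
        refine div_le_div_of_nonneg_right (sum_gcd_le S _ fun a ha => ?_) (by positivity)
        exact ⟨by have := (hS a ha).1; exact_mod_cast hX0.trans_le this, Nat.le_floor (hS a ha).2⟩
    _ ≤ (2 * X) ^ 2 * (1 + Real.log (2 * X)) / X ^ 2 := by gcongr
    _ = _ := by field_simp; ring

/-! ### Variance over a window and the counting inequality -/

/-- The variance over a window of the number of multiples of elements of `S` in an interval
of length `H`. -/
theorem sum_multCount_sub_sq_window_le (S : Finset ℕ) (M H : ℕ) (hM : 0 < M)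
    (hS : ∀ a ∈ S, 0 < a ∧ a ≤ M) (y : ℤ) (I : Finset ℤ) (hI : I ⊆ Ico 0 ((M : ℤ) ^ 2))
    (hIy : ∀ n ∈ I, 6 * |n - y| ≤ (M : ℤ) ^ 2) :
    ∑ n ∈ I, (∑ a ∈ S, (multCount H a n - H / a)) ^ 2 ≤
      4 * (M : ℝ) ^ 2 * H * ∑ a ∈ S, ∑ b ∈ S, (a.gcd b : ℝ) / (a * b) := by
  -- Only divisibility by every a matters; the size of K cancels.
  obtain ⟨K, hK, hSK⟩ : ∃ K : ℕ, 0 < K ∧ ∀ a ∈ S, a ∣ K :=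
    ⟨M.factorial, Nat.factorial_pos M, fun a ha => Nat.dvd_factorial (hS a ha).1 (hS a ha).2⟩
  have hK' : (0 : ℝ) < K := by exact_mod_cast hK
  have hIsub : I ⊆ Ico (0 : ℤ) (0 + M ^ 2 * K) := by
    refine hI.trans (Ico_subset_Ico_right ?_)
    rw [zero_add]
    exact le_mul_of_one_le_right (by positivity) (by exact_mod_cast hK)
  have hwin := sum_sq_window_le S M hS (fun a n => multCount H a n - H / a)
    (fun a _ n => by simp only [multCount_add_self]) K hK hM hSK 0 y I hIsub hIy
  have hvar := sum_multCount_sub_sq_le S H (M ^ 2 * K) 0 (by positivity) (fun a ha =>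
    ⟨(hS a ha).1, Dvd.dvd.mul_left (Int.natCast_dvd_natCast.2 (hSK a ha)) _⟩)
  refine le_of_mul_le_mul_left ?_ hK'
  refine (hwin.trans (mul_le_mul_of_nonneg_left hvar (by norm_num))).trans (le_of_eq ?_)
  push_cast
  ring

/-- If no product `m * a₁ * a₂` with `aᵢ ∈ Sᵢ ⊆ [X, 2 * X]` lies in `[X ^ 3, X ^ 3 + h]`, then one of
the sets is small. -/
theorem card_mul_card_sq_le_of_forall_notMem (X h : ℝ) (hX : 10 ≤ X) (S₁ S₂ : Finset ℕ)
    (hS₁ : ∀ a ∈ S₁, X ≤ (a : ℝ) ∧ (a : ℝ) ≤ 2 * X) (hS₂ : ∀ a ∈ S₂, X ≤ (a : ℝ) ∧ (a : ℝ) ≤ 2 * X)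
    (H : ℕ) (hH : 0 < H) (hHX : (H : ℝ) + 1 ≤ X / 4) (hHh : (2 * H + 1) * (2 * X) ≤ h)
    (hno : ∀ a₁ ∈ S₁, ∀ a₂ ∈ S₂, ∀ m : ℕ,
      X ^ 3 ≤ (m : ℝ) * a₁ * a₂ → ¬ (m : ℝ) * a₁ * a₂ ≤ X ^ 3 + h) :
    (#S₁ : ℝ) * (#S₂ : ℝ) ^ 2 * (H : ℝ) ^ 2 ≤ 256 * X ^ 4 * (1 + Real.log (2 * X)) := by
  have hX0 : 0 < X := by linarith
  have hH0 : (0 : ℝ) < H := by exact_mod_cast hH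
  set M : ℕ := ⌊2 * X⌋₊ with hMdef
  have hM1 : (M : ℝ) ≤ 2 * X := Nat.floor_le (by linarith)
  have hM2 : 2 * X - 1 < M := Nat.sub_one_lt_floor _
  have hM0' : (0 : ℝ) < M := by linarith
  have hM0 : 0 < M := by exact_mod_cast hM0'
  have hMsq : (2 * X - 1) ^ 2 ≤ (M : ℝ) ^ 2 := by nlinarith
  have hS : ∀ a ∈ S₂, 0 < a ∧ a ≤ M := fun a ha =>
    ⟨by have := (hS₂ a ha).1; exact_mod_cast hX0.trans_le this, Nat.le_floor (hS₂ a ha).2⟩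
  -- The midpoint of [X²/2, X²], which contains every X³/a.
  set y : ℤ := ⌊3 * X ^ 2 / 4⌋ with hy
  have hy1 : (y : ℝ) ≤ 3 * X ^ 2 / 4 := Int.floor_le _
  have hy2 : 3 * X ^ 2 / 4 < y + 1 := Int.lt_floor_add_one _
  set I : Finset ℤ := S₁.biUnion fun a => Ico ⌈X ^ 3 / a⌉ (⌈X ^ 3 / a⌉ + H) with hI
  have hquot : ∀ a ∈ S₁, X ^ 2 / 2 ≤ X ^ 3 / a ∧ X ^ 3 / a ≤ X ^ 2 := by
    intro a ha
    obtain ⟨h1, h2⟩ := hS₁ a ha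
    have ha0 : (0 : ℝ) < a := by linarith
    rw [le_div_iff₀ ha0, div_le_iff₀ ha0]
    constructor <;> nlinarith [sq_nonneg X, mul_le_mul_of_nonneg_left h1 (sq_nonneg X),
      mul_le_mul_of_nonneg_left h2 (sq_nonneg X)]
  have hmem : ∀ n ∈ I, ∃ a ∈ S₁, X ^ 3 / a ≤ n ∧ (n : ℝ) < X ^ 3 / a + 1 + H := by
    intro n hn
    obtain ⟨a, ha, hna⟩ := mem_biUnion.1 hn
    obtain ⟨h1, h2⟩ := mem_Ico.1 hna
    refine ⟨a, ha, Int.ceil_le.1 h1, ?_⟩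
    have h2' : (n : ℝ) < (⌈X ^ 3 / (a : ℝ)⌉ : ℝ) + H := by exact_mod_cast h2
    linarith [Int.ceil_lt_add_one (X ^ 3 / (a : ℝ))]
  have hdisj : ∀ a ∈ S₁, ∀ b ∈ S₁, a < b →
      Disjoint (Ico ⌈X ^ 3 / (a : ℝ)⌉ (⌈X ^ 3 / (a : ℝ)⌉ + H)) (Ico ⌈X ^ 3 / (b : ℝ)⌉ (⌈X ^ 3 / (b : ℝ)⌉ + H)) := by
    intro a ha b hb hab
    obtain ⟨ha1, ha2⟩ := hS₁ a ha
    obtain ⟨hb1, hb2⟩ := hS₁ b hb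
    have ha0 : (0 : ℝ) < a := by linarith
    have hb0 : (0 : ℝ) < b := by linarith
    have hab' : (a : ℝ) + 1 ≤ b := by exact_mod_cast hab
    -- Distinct quotients are at least X/4 ≥ H + 1 apart, so the blocks of H integers are disjoint
    -- even after rounding up.
    have hsp : X ^ 3 / b + X / 4 ≤ X ^ 3 / a := by
      have hprod : (a : ℝ) * b ≤ 4 * X ^ 2 := by nlinarith
      have e : X ^ 3 / a - X ^ 3 / b = X ^ 3 * (b - a) / (a * b) := by field_simp
      have : X / 4 ≤ X ^ 3 * (b - a) / (a * b) := by
        rw [le_div_iff₀ (by positivity)]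
        have h3 : X ^ 3 * 1 ≤ X ^ 3 * ((b : ℝ) - a) :=
          mul_le_mul_of_nonneg_left (by linarith) (by positivity)
        nlinarith
      linarith
    have hlt : ⌈X ^ 3 / (b : ℝ)⌉ + H < ⌈X ^ 3 / (a : ℝ)⌉ := by
      have h1 := Int.ceil_lt_add_one (X ^ 3 / (b : ℝ))
      have h2 := Int.le_ceil (X ^ 3 / (a : ℝ))
      have : (⌈X ^ 3 / (b : ℝ)⌉ : ℝ) + H < ⌈X ^ 3 / (a : ℝ)⌉ := by linarith
      exact_mod_cast this
    rw [disjoint_left]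
    intro n hn hn'
    rw [mem_Ico] at hn hn'
    omega
  have hcard : (#I : ℝ) = #S₁ * H := by
    rw [hI, card_biUnion]
    · simp
    · intro a ha b hb hab
      rcases lt_or_gt_of_ne hab with h | h
      · exact hdisj a ha b hb h
      · exact (hdisj b hb a ha h).symm
  have hIsub : I ⊆ Ico (0 : ℤ) (M ^ 2) := by
    intro n hn
    obtain ⟨a, ha, h1, h2⟩ := hmem n hn
    obtain ⟨h3, h4⟩ := hquot a ha
    rw [mem_Ico]
    constructor
    · have : (0 : ℝ) ≤ n := by nlinarith
      exact_mod_cast this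
    · have h5 : (n : ℝ) < (M : ℝ) ^ 2 := by nlinarith
      exact_mod_cast h5
  have hIy : ∀ n ∈ I, 6 * |n - y| ≤ (M : ℤ) ^ 2 := by
    intro n hn
    obtain ⟨a, ha, h1, h2⟩ := hmem n hn
    obtain ⟨h3, h4⟩ := hquot a ha
    have : 6 * |(n : ℝ) - y| ≤ (M : ℝ) ^ 2 := by
      have hb : |(n : ℝ) - y| ≤ X ^ 2 / 4 + H + 2 := by
        rw [abs_le]
        constructor <;> linarith
      nlinarith
    exact_mod_cast this
  have hwin := sum_multCount_sub_sq_window_le S₂ M H hM0 hS y I hIsub hIy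
  -- A multiple of a in (n, n + H] exceeds X³/a₁ by at most 2H + 1; times a₁ it would be a forbidden
  -- product.
  have hzero : ∀ n ∈ I, ∀ a ∈ S₂, multCount H a n = 0 := by
    intro n hn a ha
    obtain ⟨a₁, ha₁, h1, h2⟩ := hmem n hn
    obtain ⟨h3, h4⟩ := hquot a₁ ha₁
    obtain ⟨h5, h6⟩ := hS₁ a₁ ha₁
    have ha₁0 : (0 : ℝ) < a₁ := by linarith
    refine sum_eq_zero fun u hu => if_neg ?_
    rintro ⟨t, ht⟩
    obtain ⟨hu1, hu2⟩ := mem_Ioc.1 hu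
    have hu1' : (0 : ℝ) < u := by exact_mod_cast hu1
    have hu2' : (u : ℝ) ≤ H := by exact_mod_cast hu2
    have hpos : (0 : ℝ) < n + u := by nlinarith
    have hpos' : 0 < (a : ℤ) * t := by rw [← ht]; exact_mod_cast hpos
    have ht0 : 0 ≤ t := (pos_of_mul_pos_right hpos' (by positivity)).le
    lift t to ℕ using ht0
    have ht' : (t : ℝ) * a = n + u := by rw [mul_comm]; exact_mod_cast ht.symm
    have e : (t : ℝ) * a₁ * a = (n + u) * a₁ := by rw [← ht']; ring
    have hx : X ^ 3 / a₁ * a₁ = X ^ 3 := div_mul_cancel₀ _ ha₁0.ne'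
    refine hno a₁ ha₁ a ha t ?_ ?_
    · rw [e]
      calc X ^ 3 = X ^ 3 / a₁ * a₁ := hx.symm
        _ ≤ _ := mul_le_mul_of_nonneg_right (by linarith) ha₁0.le
    · rw [e]
      calc ((n : ℝ) + u) * a₁ ≤ (X ^ 3 / a₁ + (2 * H + 1)) * a₁ :=
            mul_le_mul_of_nonneg_right (by linarith) ha₁0.le
        _ = X ^ 3 + (2 * H + 1) * a₁ := by rw [add_mul, hx]
        _ ≤ X ^ 3 + (2 * H + 1) * (2 * X) := by gcongr
        _ ≤ _ := by linarith
  have hlow : (#S₁ : ℝ) * H * (H * #S₂ / (2 * X)) ^ 2 ≤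
      ∑ n ∈ I, (∑ a ∈ S₂, (multCount H a n - H / a)) ^ 2 := by
    rw [← hcard, ← nsmul_eq_mul]
    refine card_nsmul_le_sum _ _ _ fun n hn => ?_
    have e : ∑ a ∈ S₂, (multCount H a n - H / a) = -∑ a ∈ S₂, (H : ℝ) / a := by
      rw [← sum_neg_distrib]
      exact sum_congr rfl fun a ha => by rw [hzero n hn a ha, zero_sub]
    rw [e, neg_sq]
    refine pow_le_pow_left₀ (by positivity) ?_ 2
    have hb : ∀ a ∈ S₂, (H : ℝ) / (2 * X) ≤ H / a := fun a ha =>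
      div_le_div_of_nonneg_left hH0.le (by linarith [(hS₂ a ha).1]) (hS₂ a ha).2
    have := card_nsmul_le_sum _ _ _ hb
    rw [nsmul_eq_mul] at this
    refine le_trans (le_of_eq ?_) this
    ring
  have hgcd := sum_gcd_div_mul_le X (by linarith) S₂ hS₂
  have hmain : (#S₁ : ℝ) * H * (H * #S₂ / (2 * X)) ^ 2 ≤
      4 * (2 * X) ^ 2 * H * (4 * (1 + Real.log (2 * X))) := by
    refine (hlow.trans hwin).trans (mul_le_mul ?_ hgcd (by positivity) (by positivity))
    gcongr
  have e1 : (#S₁ : ℝ) * H * (H * #S₂ / (2 * X)) ^ 2 =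
      ((#S₁ : ℝ) * (#S₂ : ℝ) ^ 2 * (H : ℝ) ^ 2) * (H / (4 * X ^ 2)) := by
    field_simp; ring
  have e2 : 4 * (2 * X) ^ 2 * H * (4 * (1 + Real.log (2 * X))) =
      256 * X ^ 4 * (1 + Real.log (2 * X)) * (H / (4 * X ^ 2)) := by
    field_simp; ring
  rw [e1, e2] at hmain
  exact le_of_mul_le_mul_right hmain (by positivity)

/-! ### Choice of parameters and conclusion -/

open Filter in
theorem eventually_exists_mul_mem_Icc (A₁ A₂ : Set ℕ) (h₁ : AlmostDense A₁) (h₂ : AlmostDense A₂) :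
    ∀ᶠ X : ℝ in atTop, ∃ m a₁ a₂ : ℕ, a₁ ∈ A₁ ∧ a₂ ∈ A₂ ∧
      (X ≤ (a₁ : ℝ) ∧ (a₁ : ℝ) ≤ 2 * X) ∧ (X ≤ (a₂ : ℝ) ∧ (a₂ : ℝ) ≤ 2 * X) ∧
      X ^ 3 ≤ (m : ℝ) * a₁ * a₂ ∧ (m : ℝ) * a₁ * a₂ ≤ X ^ 3 + X ^ (5 / 3 : ℝ) := by
  -- With 1/9, the three density factors lose X^(1/12) in all, and H² ≍ X^(4/3), so the left side is
  -- ≫ X^(4 + 1/4), beating X⁴ log X.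
  obtain ⟨c₁, hc₁, hA₁⟩ := h₁.dense (1 / 9) (by norm_num)
  obtain ⟨c₂, hc₂, hA₂⟩ := h₂.dense (1 / 9) (by norm_num)
  -- Here 65536 = 256². The two bounds make log X and 2 each at most half of what is needed to
  -- contradict the counting inequality.
  have hlog := (isLittleO_log_rpow_atTop (r := 1 / 4) (by norm_num)).bound
    (c := c₁ * c₂ ^ 2 / (2 * 65536)) (by positivity)
  have hbig := (tendsto_rpow_atTop (y := 1 / 4) (by norm_num)).eventually_gt_atTop
    (4 * 65536 / (c₁ * c₂ ^ 2))
  have hbig' := (tendsto_rpow_atTop (y := 2 / 3) (by norm_num)).eventually_ge_atTop (16 : ℝ)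
  filter_upwards [hA₁, hA₂, hlog, hbig, hbig', eventually_ge_atTop (10 : ℝ)]
    with X hX₁ hX₂ hXlog hXbig hXbig' hX
  have hX0 : 0 < X := by linarith
  have hfin : ∀ A : Set ℕ, {n : ℕ | n ∈ A ∧ X ≤ (n : ℝ) ∧ (n : ℝ) ≤ 2 * X}.Finite := fun A =>
    (Set.finite_Iic ⌊2 * X⌋₊).subset fun n hn => Nat.le_floor hn.2.2
  rw [Set.ncard_eq_toFinset_card _ (hfin A₁)] at hX₁
  rw [Set.ncard_eq_toFinset_card _ (hfin A₂)] at hX₂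
  set S₁ := (hfin A₁).toFinset with hS₁
  set S₂ := (hfin A₂).toFinset with hS₂
  by_contra hno
  set H : ℕ := ⌊X ^ (2 / 3 : ℝ) / 8⌋₊ with hH
  have hH1 : (H : ℝ) ≤ X ^ (2 / 3 : ℝ) / 8 := Nat.floor_le (by positivity)
  have hH2 : X ^ (2 / 3 : ℝ) / 8 - 1 < H := Nat.sub_one_lt_floor _
  have hH3 : X ^ (2 / 3 : ℝ) / 16 ≤ H := by linarith
  have hH0 : 0 < H := by
    have : (0 : ℝ) < H := by linarith
    exact_mod_cast this
  have h23 : X ^ (2 / 3 : ℝ) ≤ X := by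
    simpa using Real.rpow_le_rpow_of_exponent_le (by linarith : (1 : ℝ) ≤ X)
      (by norm_num : (2 / 3 : ℝ) ≤ 1)
  have h53 : X ^ (5 / 3 : ℝ) = X ^ (2 / 3 : ℝ) * X := by
    rw [← Real.rpow_add_one hX0.ne']; norm_num
  have hcount := card_mul_card_sq_le_of_forall_notMem X (X ^ (5 / 3 : ℝ)) hX S₁ S₂
    (fun a ha => ((hfin A₁).mem_toFinset.1 ha).2) (fun a ha => ((hfin A₂).mem_toFinset.1 ha).2)
    H hH0 (by linarith) (by rw [h53]; nlinarith) (fun a₁ ha₁ a₂ ha₂ m hm hm' =>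
      hno ⟨m, a₁, a₂, ((hfin A₁).mem_toFinset.1 ha₁).1, ((hfin A₂).mem_toFinset.1 ha₂).1,
        ((hfin A₁).mem_toFinset.1 ha₁).2, ((hfin A₂).mem_toFinset.1 ha₂).2, hm, hm'⟩)
  have hlow : c₁ * c₂ ^ 2 / 256 * (X ^ 4 * X ^ (1 / 4 : ℝ)) ≤ (#S₁ : ℝ) * (#S₂ : ℝ) ^ 2 * (H : ℝ) ^ 2 := by
    calc c₁ * c₂ ^ 2 / 256 * (X ^ 4 * X ^ (1 / 4 : ℝ))
        = (c₁ * X ^ (1 - 1 / 9 / 4 : ℝ)) * (c₂ * X ^ (1 - 1 / 9 / 4 : ℝ)) ^ 2 *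
            (X ^ (2 / 3 : ℝ) / 16) ^ 2 := by
          have e : X ^ 4 * X ^ (1 / 4 : ℝ) = X ^ (1 - 1 / 9 / 4 : ℝ) *
              (X ^ (1 - 1 / 9 / 4 : ℝ)) ^ 2 * (X ^ (2 / 3 : ℝ)) ^ 2 := by
            rw [← Real.rpow_natCast X 4, ← Real.rpow_natCast (X ^ _) 2,
              ← Real.rpow_natCast (X ^ _) 2, ← Real.rpow_mul hX0.le, ← Real.rpow_mul hX0.le,
              ← Real.rpow_add hX0, ← Real.rpow_add hX0, ← Real.rpow_add hX0]
            norm_num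
          rw [e]; ring
      _ ≤ _ := by gcongr
  have hlogX : Real.log X ≤ c₁ * c₂ ^ 2 / (2 * 65536) * X ^ (1 / 4 : ℝ) := by
    refine (le_abs_self _).trans ?_
    simpa [abs_of_pos (Real.rpow_pos_of_pos hX0 _)] using hXlog
  have hlog2 : 1 + Real.log (2 * X) < 2 + Real.log X := by
    rw [Real.log_mul (by norm_num) hX0.ne']
    linarith [Real.log_two_lt_d9]
  rw [div_lt_iff₀ (by positivity)] at hXbig
  have hX4 : 0 < X ^ 4 := by positivity
  have : c₁ * c₂ ^ 2 / 256 * X ^ (1 / 4 : ℝ) ≤ 256 * (1 + Real.log (2 * X)) := by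
    refine le_of_mul_le_mul_left ?_ hX4
    linarith
  linarith

theorem theorem1 :
    ∃ c C : ℝ, 0 < c ∧ 0 < C ∧
      ∀ ε : ℝ, 0 < ε → ∀ A₁ A₂ : Set ℕ, AlmostDense A₁ → AlmostDense A₂ →
        ∀ᶠ x : ℝ in Filter.atTop, ∃ m a₁ a₂ : ℕ, a₁ ∈ A₁ ∧ a₂ ∈ A₂ ∧
          ((m * a₁ * a₂ : ℕ) : ℝ) ∈ Set.Icc x (x + x ^ (5 / 9 + ε)) ∧
          (m : ℝ) ∈ Set.Icc (c * x ^ (1 / 3 : ℝ)) (C * x ^ (1 / 3 : ℝ)) ∧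
          (a₁ : ℝ) ∈ Set.Icc (c * x ^ (1 / 3 : ℝ)) (C * x ^ (1 / 3 : ℝ)) ∧
          (a₂ : ℝ) ∈ Set.Icc (c * x ^ (1 / 3 : ℝ)) (C * x ^ (1 / 3 : ℝ)) := by
  -- From X² ≤ a₁a₂ ≤ 4X² and X³ ≤ m a₁a₂ ≤ 2X³ one gets X/4 ≤ m ≤ 2X.
  refine ⟨1 / 4, 2, by norm_num, by norm_num, fun ε hε A₁ A₂ h₁ h₂ => ?_⟩
  have hev := (tendsto_rpow_atTop (y := 1 / 3) (by norm_num)).eventually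
    (eventually_exists_mul_mem_Icc A₁ A₂ h₁ h₂)
  filter_upwards [hev, Filter.eventually_ge_atTop (1 : ℝ)] with x hx hx1
  obtain ⟨m, a₁, a₂, ha₁, ha₂, ⟨h3, h4⟩, ⟨h5, h6⟩, h7, h8⟩ := hx
  have hx0 : 0 < x := by linarith
  set X : ℝ := x ^ (1 / 3 : ℝ) with hXdef
  have hX1 : 1 ≤ X := Real.one_le_rpow hx1 (by norm_num)
  have hX3 : X ^ 3 = x := by
    rw [hXdef, ← Real.rpow_natCast, ← Real.rpow_mul hx0.le]; norm_num
  have hX53 : X ^ (5 / 3 : ℝ) = x ^ (5 / 9 : ℝ) := by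
    rw [hXdef, ← Real.rpow_mul hx0.le]; norm_num
  have hX53' : X ^ (5 / 3 : ℝ) ≤ X ^ 3 := by
    rw [← Real.rpow_natCast X 3]
    exact Real.rpow_le_rpow_of_exponent_le hX1 (by norm_num)
  have hprod1 : X ^ 2 ≤ (a₁ : ℝ) * a₂ := by nlinarith
  have hprod2 : (a₁ : ℝ) * a₂ ≤ 4 * X ^ 2 := by nlinarith
  have hm0 : (0 : ℝ) ≤ m := by positivity
  have hX2 : 0 < X ^ 2 := by positivity
  rw [mul_assoc] at h7 h8
  refine ⟨m, a₁, a₂, ha₁, ha₂, ⟨?_, ?_⟩, ⟨?_, ?_⟩, ⟨by linarith, h4⟩, ⟨by linarith, h6⟩⟩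
  · push_cast
    rw [mul_assoc, ← hX3]
    exact h7
  · push_cast
    -- The argument already gives exponent 5/9; ε only enlarges the interval.
    have : x ^ (5 / 9 : ℝ) ≤ x ^ (5 / 9 + ε) := Real.rpow_le_rpow_of_exponent_le hx1 (by linarith)
    rw [mul_assoc]
    linarith
  · have : X ^ 2 * (1 / 4 * X) ≤ X ^ 2 * m := by
      nlinarith [mul_le_mul_of_nonneg_left hprod2 hm0]
    exact le_of_mul_le_mul_left this hX2
  · have : X ^ 2 * m ≤ X ^ 2 * (2 * X) := by
      nlinarith [mul_le_mul_of_nonneg_left hprod1 hm0]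
    exact le_of_mul_le_mul_left this hX2
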